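/- Let $d\ge 1$ and let $\Omega\subset\mathbb R^d$ be a bounded open polyhedral set whose closure is the union of finitely many closed $d$-simplices $\bar T_j$ forming a conforming mesh (two simplices meet exactly in the convex hull of their common vertices). Let $W_h$ be the space of functions that are continuous on $\bar\Omega$ and affine on every $\bar T_j$ (piecewise linear finite elements), and $Y_h=\{\varphi\in W_h:\varphi=0\text{ on }\partial\Omega\}$. Let $S_h:L^2(\Omega)\to L^2(\Omega)$ be the discrete solution operator: $S_hu\in Y_h$ and $\int_\Omega\nabla (S_hu)\cdot\nabla\psi\,dx=\int_\Omega u\,\psi\,dx$ for all $\psi\in Y_h$; let $S_h^*$ be its adjoint in $L^2(\Omega)$. Fix $\alpha>0$, $z\in L^2(\Omega)$ and $a,b\in W_h$ with $a<b$ in $\Omega$, put $p_h(v)=S_h^*(S_hv-z)$ and $$G_h(v)=v-P_{[a,b]}\Big(-\tfrac1\alpha p_h(v)\Big),\qquad v\in L^2(\Omega),$$ where $P_{[a,b]}(f)=\max(a,\min(f,b))$ pointwise a.e. For real numbers $a<b$ let $\partial P_{[a,b]}(x)$ be $\{0\}$ if $x\notin[a,b]$, $\{1\}$ if $x\in(a,b)$,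 and $[0,1]$ if $x\in\{a,b\}$. Write $G_h(v)=v-\big((b-a)P_{[0,1]}(F(v))+a\big)$ with the affine map $F(v)=(b-a)^{-1}\big(-\frac1\alpha p_h(v)-a\big)$, whose derivative is $F'w=-\frac1\alpha(b-a)^{-1}S_h^*S_hw$, and let $\partial G_h(v)$ be the set of bounded linear operators $M$ on $L^2(\Omega)$ of the form $Mw=w-(b-a)\,g\,F'w$, where $g$ is a measurable function with $g(\omega)\in\partial P_{[0,1]}(F(v)(\omega))$ for a.e. $\omega\in\Omega$. Then the following hold. 1. For every $v\in L^2(\Omega)$, $$\partial G_h(v)w=w+\tfrac1\alpha\,\partial P_{[a,b]}\Big(-\tfrac1\alpha p_h(v)\Big)\cdot(S_h^*S_hw),$$ that is, $\partial G_h(v)$ is exactly the set of bounded linear operators $M$ on $L^2(\Omega)$ for which there is a measurable $g$ with $g(\omega)\in\partial P_{[a(\omega),b(\omega)]}\big(-\frac1\alpha p_h(v)(\omega)\big)$ a.e. in $\Omega$ and $Mw=w+\frac1\alpha\,g\cdot S_h^*S_hw$ a.e. in $\Omega$ for all $w\in L^2(\Omega)$. 2. For every $\mu$ with $0<\mu<\frac13$,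 $G_h$ is $\partial G_h$-semismooth of order $\mu$ at every $v\in L^2(\Omega)$: all sets $\partial G_h(\cdot)$ are nonempty, $G_h$ is continuous near $v$, and $$\sup_{M\in\partial G_h(v+s)}\|G_h(v+s)-G_h(v)-Ms\|_{L^2(\Omega)}=O\big(\|s\|_{L^2(\Omega)}^{1+\mu}\big)\quad\text{as }s\to0.$$ 3. Consequently the semismooth Newton method converges locally superlinearly of order $1+\mu$: if $0<\mu<\frac13$, $G_h(u)=0$ and $C\in\mathbb R$, there are $\delta>0$ and $K$ such that every sequence $(v_n)$ with $\|v_0-u\|<\delta$ and $M_n(v_{n+1}-v_n)=-G_h(v_n)$, where each $M_n\in\partial G_h(v_n)$ is boundedly invertible with $\|M_n^{-1}\|\le C$, converges to $u$ and satisfies $\|v_{n+1}-u\|\le K\|v_n-u\|^{1+\mu}$ for all $n$. -/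

import Mathlib

open MeasureTheory Filter Topology Set

noncomputable section

namespace VarDisc

/-- A bounded open polyhedral set `dom` in `ℝᵈ` together with an admissible (conforming) partition
of its closure into finitely many closed `d`-simplices, each given by its set of vertices. -/
structure FEMesh (d : ℕ) where
  dom : Set (EuclideanSpace ℝ (Fin d))
  isOpen_dom : IsOpen dom
  cells : Set (Finset (EuclideanSpace ℝ (Fin d)))
  finite_cells : cells.Finite
  card_cell : ∀ s ∈ cells, s.card = d + 1
  affineIndependent_cell : ∀ s ∈ cells,
    AffineIndependent ℝ (fun x : s => (x : EuclideanSpace ℝ (Fin d)))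
  conforming : ∀ s ∈ cells, ∀ t ∈ cells,
    convexHull ℝ (s : Set (EuclideanSpace ℝ (Fin d))) ∩ convexHull ℝ (t : Set _) =
      convexHull ℝ ((s : Set (EuclideanSpace ℝ (Fin d))) ∩ (t : Set _))
  closure_dom : closure dom = ⋃ s ∈ cells, convexHull ℝ (s : Set (EuclideanSpace ℝ (Fin d)))

theorem continuous_comp_inner {H Y : Type*} [NormedAddCommGroup H] [InnerProductSpace ℝ H]
    [AddCommGroup Y] [Module ℝ Y] [FiniteDimensional ℝ Y] (j : Y →ₗ[ℝ] H)
    (A : Module.Dual ℝ Y →ₗ[ℝ] Y) :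
    Continuous fun u : H => j (A ((innerₗ H u) ∘ₗ j)) := by
  let V : Submodule ℝ H := LinearMap.range j
  let r : (V →L[ℝ] ℝ) →ₗ[ℝ] Module.Dual ℝ Y :=
    { toFun := fun l => l.toLinearMap ∘ₗ j.rangeRestrict
      map_add' := fun _ _ => rfl
      map_smul' := fun _ _ => rfl }
  have hK : Continuous (j ∘ₗ A ∘ₗ r) := LinearMap.continuous_of_finiteDimensional _
  have hl : Continuous fun u : H => (innerSL ℝ u).comp V.subtypeL :=
    (innerSL ℝ).continuous.clm_comp continuous_const
  exact hK.comp hl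

variable {d : ℕ} (T : FEMesh d)

namespace FEMesh

/-- Lebesgue measure on the domain. -/
abbrev vol : Measure (EuclideanSpace ℝ (Fin d)) := volume.restrict T.dom

/-- The real Hilbert space `L²(Ω)`. -/
abbrev L2 : Type := Lp ℝ 2 T.vol

/-- The finite element space `W_h`: functions that are continuous on the closure of the domain and
affine on every cell (their values outside the closure of the domain play no role). -/
def W : Submodule ℝ (EuclideanSpace ℝ (Fin d) → ℝ) where
  carrier := {φ | ContinuousOn φ (closure T.dom) ∧
    ∀ s ∈ T.cells, ∃ A : EuclideanSpace ℝ (Fin d) →ᵃ[ℝ] ℝ,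
      EqOn φ A (convexHull ℝ (s : Set (EuclideanSpace ℝ (Fin d))))}
  add_mem' := by
    rintro φ ψ ⟨hφ, hφ'⟩ ⟨hψ, hψ'⟩
    refine ⟨hφ.add hψ, fun s hs => ?_⟩
    obtain ⟨A, hA⟩ := hφ' s hs
    obtain ⟨B, hB⟩ := hψ' s hs
    exact ⟨A + B, fun x hx => by simp [hA hx, hB hx]⟩
  zero_mem' := ⟨continuousOn_const, fun s _ => ⟨0, fun x _ => by simp⟩⟩
  smul_mem' := by
    rintro c φ ⟨hφ, hφ'⟩
    refine ⟨hφ.const_smul c, fun s hs => ?_⟩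
    obtain ⟨A, hA⟩ := hφ' s hs
    exact ⟨c • A, fun x hx => by simp [hA hx]⟩

/-- The finite element space `Y_h`: members of `W_h` that vanish on the boundary of the domain.
They are extended by zero outside the domain. -/
def Y : Submodule ℝ (EuclideanSpace ℝ (Fin d) → ℝ) where
  carrier := {φ | φ ∈ T.W ∧ ∀ x, x ∉ T.dom → φ x = 0}
  add_mem' := by
    rintro φ ψ ⟨hφ, hφ'⟩ ⟨hψ, hψ'⟩
    exact ⟨T.W.add_mem hφ hψ, fun x hx => by simp [hφ' x hx, hψ' x hx]⟩
  zero_mem' := ⟨T.W.zero_mem, fun x _ => rfl⟩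
  smul_mem' := by
    rintro c φ ⟨hφ, hφ'⟩
    exact ⟨T.W.smul_mem c hφ, fun x hx => by simp [hφ' x hx]⟩

theorem Y_le_W : T.Y ≤ T.W := fun _ h => h.1

/-- The Dirichlet form `a(φ, ψ) = ∫_Ω ∇φ · ∇ψ dx`. -/
def energy (φ ψ : EuclideanSpace ℝ (Fin d) → ℝ) : ℝ :=
  ∫ x in T.dom, inner ℝ (gradient φ x) (gradient ψ x)

theorem isCompact_closure : IsCompact (closure T.dom) := by
  rw [T.closure_dom]
  exact T.finite_cells.isCompact_biUnion fun s _ => s.finite_toSet.isCompact_convexHull ℝ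

theorem volume_dom_lt_top : volume T.dom < ⊤ :=
  (measure_mono subset_closure).trans_lt T.isCompact_closure.measure_lt_top

instance : IsFiniteMeasure T.vol := ⟨by
  rw [Measure.restrict_apply_univ]; exact T.volume_dom_lt_top⟩

theorem memLp_of_mem_W {φ : EuclideanSpace ℝ (Fin d) → ℝ} (h : φ ∈ T.W) : MemLp φ 2 T.vol := by
  obtain ⟨C, hC⟩ := T.isCompact_closure.exists_bound_of_continuousOn h.1
  refine MemLp.of_bound ((h.1.mono subset_closure).aestronglyMeasurable
    T.isOpen_dom.measurableSet) C ?_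
  exact (ae_restrict_mem T.isOpen_dom.measurableSet).mono fun x hx => hC x (subset_closure hx)

/-- The canonical map `W_h → L²(Ω)`. -/
def WtoL2 : T.W →ₗ[ℝ] T.L2 where
  toFun φ := (T.memLp_of_mem_W φ.2).toLp φ
  map_add' _ _ := rfl
  map_smul' _ _ := rfl

/-- The canonical map `Y_h → L²(Ω)`. -/
def YtoL2 : T.Y →ₗ[ℝ] T.L2 := T.WtoL2 ∘ₗ Submodule.inclusion T.Y_le_W

theorem coeFn_YtoL2 (φ : T.Y) :
    T.YtoL2 φ =ᵐ[T.vol] (φ : EuclideanSpace ℝ (Fin d) → ℝ) :=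
  MemLp.coeFn_toLp (T.memLp_of_mem_W φ.2.1)

theorem continuous_of_mem_Y {φ : EuclideanSpace ℝ (Fin d) → ℝ} (h : φ ∈ T.Y) : Continuous φ := by
  rw [← continuousOn_univ]
  have hc : IsClosed (T.domᶜ) := T.isOpen_dom.isClosed_compl
  have hu : (univ : Set (EuclideanSpace ℝ (Fin d))) = closure T.dom ∪ T.domᶜ := by
    symm; rw [eq_univ_iff_forall]; intro x
    by_cases hx : x ∈ T.dom
    · exact Or.inl (subset_closure hx)
    · exact Or.inr hx
  rw [hu]
  refine ContinuousOn.union_of_isClosed h.1.1 ?_ isClosed_closure hc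
  exact (continuousOn_const (c := (0 : ℝ))).congr fun x hx => h.2 x hx

theorem YtoL2_injective : Function.Injective T.YtoL2 := by
  rw [injective_iff_map_eq_zero]
  intro φ hφ
  have h1 : (φ : EuclideanSpace ℝ (Fin d) → ℝ) =ᵐ[T.vol] 0 := by
    refine (T.coeFn_YtoL2 φ).symm.trans ?_
    rw [hφ]; exact Lp.coeFn_zero _ _ _
  have h2 : EqOn (φ : EuclideanSpace ℝ (Fin d) → ℝ) 0 T.dom :=
    Measure.eqOn_open_of_ae_eq h1 T.isOpen_dom (T.continuous_of_mem_Y φ.2).continuousOn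
      continuousOn_const
  ext x
  by_cases hx : x ∈ T.dom
  · exact h2 hx
  · exact φ.2.2 x hx

instance : FiniteDimensional ℝ T.Y := by
  let V : Set (EuclideanSpace ℝ (Fin d)) := ⋃ s ∈ T.cells, (s : Set _)
  have hV : V.Finite := T.finite_cells.biUnion fun s _ => s.finite_toSet
  have : Finite V := hV
  let r : T.Y →ₗ[ℝ] (V → ℝ) :=
    { toFun := fun φ x => φ.1 x
      map_add' := fun _ _ => rfl
      map_smul' := fun _ _ => rfl }
  refine Module.Finite.of_injective r ?_
  rw [injective_iff_map_eq_zero]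
  intro φ hφ
  ext x
  by_cases hx : x ∈ T.dom
  · have hx' := subset_closure hx
    rw [T.closure_dom] at hx'
    simp only [mem_iUnion, exists_prop] at hx'
    obtain ⟨s, hs, hxs⟩ := hx'
    obtain ⟨A, hA⟩ := φ.2.1.2 s hs
    have hsub : (s : Set (EuclideanSpace ℝ (Fin d))) ⊆ A ⁻¹' {0} := by
      intro y hy
      have hyV : y ∈ V := mem_biUnion hs hy
      have := congrFun hφ ⟨y, hyV⟩
      have h0 : φ.1 y = 0 := this
      rw [hA (subset_convexHull ℝ _ hy)] at h0
      exact h0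
    have hconv : Convex ℝ (A ⁻¹' {0}) := (convex_singleton (0 : ℝ)).affine_preimage A
    have := convexHull_min hsub hconv hxs
    rw [hA hxs]
    exact this
  · exact φ.2.2 x hx

/-- Almost every point of the domain lies in the interior of a cell. -/
theorem ae_mem_interior : ∀ᵐ x ∂T.vol, ∃ s ∈ T.cells,
    x ∈ interior (convexHull ℝ (s : Set (EuclideanSpace ℝ (Fin d)))) := by
  have h1 : ∀ᵐ x ∂T.vol, ∀ s ∈ T.cells,
      x ∉ frontier (convexHull ℝ (s : Set (EuclideanSpace ℝ (Fin d)))) := by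
    rw [ae_ball_iff T.finite_cells.countable]
    intro s _
    have h0 := (convex_convexHull ℝ (s : Set (EuclideanSpace ℝ (Fin d)))).addHaar_frontier volume
    exact ae_restrict_of_ae (measure_eq_zero_iff_ae_notMem.1 h0)
  filter_upwards [h1, ae_restrict_mem T.isOpen_dom.measurableSet] with x hx hxd
  have hx' := subset_closure hxd
  rw [T.closure_dom] at hx'
  simp only [mem_iUnion, exists_prop] at hx'
  obtain ⟨s, hs, hxs⟩ := hx'
  refine ⟨s, hs, ?_⟩
  have := hx s hs
  rw [frontier, Set.mem_sdiff, not_and, not_not] at this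
  exact this (subset_closure hxs)

theorem hasFDerivAt_of_eqOn {φ : EuclideanSpace ℝ (Fin d) → ℝ}
    {A : EuclideanSpace ℝ (Fin d) →ᵃ[ℝ] ℝ} {S : Set (EuclideanSpace ℝ (Fin d))}
    (h : EqOn φ A S) {x : EuclideanSpace ℝ (Fin d)} (hx : x ∈ interior S) :
    HasFDerivAt φ (LinearMap.toContinuousLinearMap A.linear) x := by
  have hA : HasFDerivAt A (LinearMap.toContinuousLinearMap A.linear) x := by
    have h1 : (A : EuclideanSpace ℝ (Fin d) → ℝ) =
        fun y => LinearMap.toContinuousLinearMap A.linear y + A 0 := by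
      ext y
      simpa using congrFun (AffineMap.decomp A) y
    rw [h1]
    exact (ContinuousLinearMap.hasFDerivAt _).add_const _
  refine hA.congr_of_eventuallyEq ?_
  filter_upwards [mem_interior_iff_mem_nhds.1 hx] with y hy using h hy

theorem ae_differentiableAt {φ : EuclideanSpace ℝ (Fin d) → ℝ} (h : φ ∈ T.W) :
    ∀ᵐ x ∂T.vol, DifferentiableAt ℝ φ x := by
  filter_upwards [T.ae_mem_interior] with x ⟨s, hs, hx⟩
  obtain ⟨A, hA⟩ := h.2 s hs
  exact (hasFDerivAt_of_eqOn hA hx).differentiableAt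

theorem exists_gradient_bound {φ : EuclideanSpace ℝ (Fin d) → ℝ} (h : φ ∈ T.W) :
    ∃ C : ℝ, ∀ᵐ x ∂T.vol, ‖gradient φ x‖ ≤ C := by
  choose! A hA using h.2
  obtain ⟨C, hC⟩ := (T.finite_cells.image
    fun s => ‖LinearMap.toContinuousLinearMap (A s).linear‖).bddAbove
  refine ⟨C, ?_⟩
  filter_upwards [T.ae_mem_interior] with x ⟨s, hs, hx⟩
  rw [gradient, (hasFDerivAt_of_eqOn (hA s hs) hx).fderiv, LinearIsometryEquiv.norm_map]
  exact hC (mem_image_of_mem _ hs)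

theorem aestronglyMeasurable_gradient (φ : EuclideanSpace ℝ (Fin d) → ℝ) :
    AEStronglyMeasurable (gradient φ) T.vol := by
  have h1 : Measurable (gradient φ) :=
    (InnerProductSpace.toDual ℝ (EuclideanSpace ℝ (Fin d))).symm.continuous.measurable.comp
      (measurable_fderiv ℝ φ)
  exact h1.aestronglyMeasurable

theorem integrable_gradient {φ ψ : EuclideanSpace ℝ (Fin d) → ℝ} (hφ : φ ∈ T.W) (hψ : ψ ∈ T.W) :
    Integrable (fun x => inner ℝ (gradient φ x) (gradient ψ x)) T.vol := by
  obtain ⟨C, hC⟩ := T.exists_gradient_bound hφ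
  obtain ⟨D, hD⟩ := T.exists_gradient_bound hψ
  refine Integrable.of_bound ((T.aestronglyMeasurable_gradient φ).inner
    (T.aestronglyMeasurable_gradient ψ)) (C * D) ?_
  filter_upwards [hC, hD] with x h1 h2
  exact (norm_inner_le_norm _ _).trans
    (mul_le_mul h1 h2 (norm_nonneg _) ((norm_nonneg _).trans h1))

theorem energy_add_left {φ φ' ψ : EuclideanSpace ℝ (Fin d) → ℝ} (hφ : φ ∈ T.W) (hφ' : φ' ∈ T.W)
    (hψ : ψ ∈ T.W) : T.energy (φ + φ') ψ = T.energy φ ψ + T.energy φ' ψ := by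
  rw [energy, energy, energy, ← integral_add (T.integrable_gradient hφ hψ)
    (T.integrable_gradient hφ' hψ)]
  refine integral_congr_ae ?_
  filter_upwards [T.ae_differentiableAt hφ, T.ae_differentiableAt hφ'] with x h1 h2
  rw [← inner_add_left]
  simp only [gradient, fderiv_add h1 h2, map_add]

theorem energy_smul_left (c : ℝ) {φ ψ : EuclideanSpace ℝ (Fin d) → ℝ} (hφ : φ ∈ T.W) :
    T.energy (c • φ) ψ = c * T.energy φ ψ := by
  rw [energy, energy, ← integral_const_mul]
  refine integral_congr_ae ?_
  filter_upwards [T.ae_differentiableAt hφ] with x h1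
  simp only [gradient, fderiv_const_smul h1 c, map_smul, real_inner_smul_left]

theorem energy_comm (φ ψ : EuclideanSpace ℝ (Fin d) → ℝ) : T.energy φ ψ = T.energy ψ φ := by
  simp only [energy, real_inner_comm]

/-- The Dirichlet form as a bilinear form on `Y_h`. -/
def energyForm : T.Y →ₗ[ℝ] T.Y →ₗ[ℝ] ℝ :=
  LinearMap.mk₂ ℝ (fun φ ψ => T.energy φ ψ)
    (fun φ φ' ψ => T.energy_add_left φ.2.1 φ'.2.1 ψ.2.1)
    (fun c φ _ => T.energy_smul_left c φ.2.1)
    (fun φ ψ ψ' => by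
      rw [T.energy_comm, T.energy_comm φ ψ, T.energy_comm φ ψ']
      exact T.energy_add_left ψ.2.1 ψ'.2.1 φ.2.1)
    (fun c φ ψ => by
      rw [T.energy_comm, T.energy_comm φ ψ]
      exact T.energy_smul_left c ψ.2.1)

theorem eq_zero_of_energy_eq_zero [NeZero d] (φ : T.Y) (h : T.energy φ φ = 0) : φ = 0 := by
  have hcont := T.continuous_of_mem_Y φ.2
  have hgrad : ∀ᵐ x ∂T.vol, gradient φ.1 x = 0 := by
    have h1 := (integral_eq_zero_iff_of_nonneg
      (fun x => real_inner_self_nonneg (x := gradient φ.1 x))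
      (T.integrable_gradient φ.2.1 φ.2.1)).1 h
    filter_upwards [h1] with x hx
    simpa using hx
  have hconst : ∀ s ∈ T.cells, ∃ c : ℝ, ∀ x ∈ convexHull ℝ
      (s : Set (EuclideanSpace ℝ (Fin d))), φ.1 x = c := by
    intro s hs
    obtain ⟨A, hA⟩ := φ.2.1.2 s hs
    have hint : (interior (convexHull ℝ (s : Set (EuclideanSpace ℝ (Fin d))))).Nonempty := by
      rw [interior_convexHull_nonempty_iff_affineSpan_eq_top]
      have h2 := (T.affineIndependent_cell s hs).affineSpan_eq_top_iff_card_eq_finrank_add_one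
      have h3 : range (fun x : s => (x : EuclideanSpace ℝ (Fin d))) = s := Subtype.range_coe
      rw [h3] at h2
      refine h2.2 ?_
      simp [T.card_cell s hs]
    have hne : (interior (convexHull ℝ (s : Set (EuclideanSpace ℝ (Fin d)))) ∩ T.dom).Nonempty := by
      obtain ⟨x, hx⟩ := hint
      have hxc : x ∈ closure T.dom := by
        rw [T.closure_dom]; exact mem_biUnion hs (interior_subset hx)
      exact mem_closure_iff.1 hxc _ isOpen_interior hx
    have hpos := (isOpen_interior.inter T.isOpen_dom).measure_pos volume hne
    have hex : ∃ x ∈ interior (convexHull ℝ (s : Set (EuclideanSpace ℝ (Fin d)))) ∩ T.dom,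
        gradient φ.1 x = 0 := by
      by_contra hcon
      push Not at hcon
      rw [ae_restrict_iff' T.isOpen_dom.measurableSet] at hgrad
      have hz : volume (interior (convexHull ℝ (s : Set (EuclideanSpace ℝ (Fin d)))) ∩ T.dom) = 0 :=
        measure_mono_null (fun x hx => by
          rw [mem_compl_iff, mem_ofPred_eq]
          exact fun hx' => hcon x hx (hx' hx.2)) (mem_ae_iff.1 hgrad)
      exact hpos.ne' hz
    obtain ⟨x, hx, hgx⟩ := hex
    rw [gradient, (hasFDerivAt_of_eqOn hA hx.1).fderiv] at hgx
    have hlin : A.linear = 0 := by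
      have := (LinearIsometryEquiv.map_eq_zero_iff _).1 hgx
      simpa using this
    refine ⟨A 0, fun y hy => ?_⟩
    rw [hA hy]
    have := congrFun (AffineMap.decomp A) y
    simpa [hlin] using this
  have hfin : (range φ.1).Finite := by
    choose! c hc using hconst
    refine ((T.finite_cells.image c).union (finite_singleton (0 : ℝ))).subset ?_
    rintro _ ⟨x, rfl⟩
    by_cases hx : x ∈ T.dom
    · have hx' := subset_closure hx
      rw [T.closure_dom] at hx'
      simp only [mem_iUnion, exists_prop] at hx'
      obtain ⟨s, hs, hxs⟩ := hx'
      exact Or.inl ⟨s, hs, (hc s hs x hxs).symm⟩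
    · exact Or.inr (φ.2.2 x hx)
  have hsub : (range φ.1).Subsingleton :=
    by_contra fun hn => (isPreconnected_range hcont).infinite_of_nontrivial
      (not_subsingleton_iff.1 hn) hfin
  obtain ⟨x₀, hx₀⟩ : ∃ x₀, x₀ ∉ T.dom := by
    by_contra hcon
    push Not at hcon
    have huniv : closure T.dom = univ := by
      rw [eq_univ_iff_forall]; exact fun x => subset_closure (hcon x)
    have hcomp := T.isCompact_closure
    rw [huniv] at hcomp
    exact noncompact_univ _ hcomp
  ext x
  exact (hsub ⟨x, rfl⟩ ⟨x₀, rfl⟩).trans (φ.2.2 x₀ hx₀)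

theorem energyForm_injective [NeZero d] : Function.Injective T.energyForm := by
  rw [injective_iff_map_eq_zero]
  intro φ hφ
  exact T.eq_zero_of_energy_eq_zero φ (congrArg (fun l => l φ) hφ)

/-- The discrete Laplacian `φ ↦ a(φ, ·)` from `Y_h` onto its dual. -/
def stiffness [NeZero d] : T.Y ≃ₗ[ℝ] Module.Dual ℝ T.Y :=
  LinearMap.linearEquivOfInjective T.energyForm T.energyForm_injective Subspace.dual_finrank_eq.symm

/-- The load functional `ψ ↦ ⟨u, ψ⟩_{L²(Ω)}` on `Y_h`. -/
def load : T.L2 →ₗ[ℝ] Module.Dual ℝ T.Y :=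
  (LinearMap.lcomp ℝ ℝ T.YtoL2) ∘ₗ (innerₗ T.L2)

/-- The discrete solution operator with values in `Y_h`. -/
def solve [NeZero d] : T.L2 →ₗ[ℝ] T.Y := T.stiffness.symm.toLinearMap ∘ₗ T.load

/-- `solve u` is a solution of the discrete state equation. -/
theorem solve_spec [NeZero d] (u : T.L2) (ψ : T.Y) :
    T.energy (T.solve u) ψ = ∫ x in T.dom, u x * (ψ : EuclideanSpace ℝ (Fin d) → ℝ) x := by
  have h1 : T.stiffness (T.solve u) = T.load u := by simp [solve]
  have h2 : T.energy (T.solve u) ψ = T.load u ψ := by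
    rw [← h1]; rfl
  rw [h2]
  change inner ℝ u (T.YtoL2 ψ) = _
  rw [L2.inner_def]
  refine integral_congr_ae ?_
  filter_upwards [T.coeFn_YtoL2 ψ] with x hx
  rw [hx]
  simp [mul_comm]

/-- The discrete state equation has no other solution than `solve u`. -/
theorem solve_unique [NeZero d] (u : T.L2) (φ : T.Y)
    (h : ∀ ψ : T.Y, T.energy φ ψ = ∫ x in T.dom, u x * (ψ : EuclideanSpace ℝ (Fin d) → ℝ) x) :
    φ = T.solve u := by
  refine T.energyForm_injective (LinearMap.ext fun ψ => ?_)
  exact (h ψ).trans (T.solve_spec u ψ).symm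

theorem continuous_solve [NeZero d] :
    Continuous (T.YtoL2 ∘ₗ T.solve : T.L2 →ₗ[ℝ] T.L2) := by
  exact continuous_comp_inner T.YtoL2 T.stiffness.symm.toLinearMap

/-- The discrete solution operator `S_h` on `L²(Ω)`: `S_h u` is the element of `Y_h` with
`a(S_h u, ψ) = ⟨u, ψ⟩_{L²(Ω)}` for all `ψ` in `Y_h`. -/
def S [NeZero d] : T.L2 →L[ℝ] T.L2 := ⟨T.YtoL2 ∘ₗ T.solve, T.continuous_solve⟩

/-- The Hilbert space adjoint `S_h^*` of `S_h` in `L²(Ω)`. -/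
def Sadj [NeZero d] : T.L2 →L[ℝ] T.L2 := ContinuousLinearMap.adjoint T.S

/-- The discrete adjoint state `p_h(y_h(v)) = S_h^* (S_h v - z)` with desired state `z`. -/
def adjointState [NeZero d] (z v : T.L2) : T.L2 := T.Sadj (T.S v - z)

/-- The adjoint state is the element `p` of `Y_h` with `a(ψ, p) = ⟨S_h v - z, ψ⟩_{L²(Ω)}` for all
`ψ` in `Y_h`. -/
theorem adjointState_eq [NeZero d] (z v : T.L2) :
    T.adjointState z v = T.YtoL2 (T.solve (T.S v - z)) := by
  have h : ∀ u w : T.L2, inner ℝ u (T.YtoL2 (T.solve w)) = T.energy (T.solve u) (T.solve w) := by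
    intro u w
    rw [T.solve_spec u (T.solve w), L2.inner_def]
    refine integral_congr_ae ?_
    filter_upwards [T.coeFn_YtoL2 (T.solve w)] with x hx
    rw [hx]
    simp [mul_comm]
  refine ext_inner_left ℝ fun u => ?_
  rw [adjointState, Sadj, ContinuousLinearMap.adjoint_inner_right, h]
  change inner ℝ (T.YtoL2 (T.solve u)) _ = _
  rw [real_inner_comm, h, T.energy_comm]

/-- The nonsmooth operator `G_h(v) = v - P_{[a, b]}(-(1/α) p_h(y_h(v)))` on `L²(Ω)`, where
`P_{[a, b]} f = max(a, min(f, b))` is the pointwise projection. -/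
def G [NeZero d] (α : ℝ) (z : T.L2) (a b : T.W) (v : T.L2) : T.L2 :=
  v - (T.WtoL2 a ⊔ ((-(1 / α)) • T.adjointState z v ⊓ T.WtoL2 b))

end FEMesh

/-- The generalized differential of the projection of `ℝ` onto `[a, b]`. -/
def dProj (a b : ℝ) (x : ℝ) : Set ℝ :=
  {g | (x ∉ Icc a b → g = 0) ∧ (x ∈ Ioo a b → g = 1) ∧ (x = a ∨ x = b → g ∈ Icc (0 : ℝ) 1)}

namespace FEMesh

/-- The inner function of the representation
`G_h(v) = v - ((b - a) P_{[0, 1]}(F(v)) + a)`, namely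
`F(v) = (b - a)⁻¹ (-(1/α) S_h^* (S_h v - z) - a)`. -/
def F [NeZero d] (α : ℝ) (z : T.L2) (a b : T.W) (v : T.L2) (x : EuclideanSpace ℝ (Fin d)) : ℝ :=
  (b.1 x - a.1 x)⁻¹ * (-(1 / α) * T.adjointState z v x - a.1 x)

/-- The (constant) derivative `F'(v) w = (b - a)⁻¹ (-(1/α) S_h^* S_h w)` of the affine map `F`. -/
def F' [NeZero d] (α : ℝ) (a b : T.W) (w : T.L2) (x : EuclideanSpace ℝ (Fin d)) : ℝ :=
  (b.1 x - a.1 x)⁻¹ * (-(1 / α) * T.Sadj (T.S w) x)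

/-- The generalized differential of `G_h = id - ((b - a) P_{[0, 1]}(F) + a)` by the chain rule for
superposition operators: it consists of the operators `w ↦ w - (b - a) g F'(v) w`, where `g` is a
measurable selection of `∂P_{[0, 1]}(F(v)(·))`. -/
def dG [NeZero d] (α : ℝ) (z : T.L2) (a b : T.W) (v : T.L2) : Set (T.L2 →L[ℝ] T.L2) :=
  {M | ∃ g : EuclideanSpace ℝ (Fin d) → ℝ, AEStronglyMeasurable g T.vol ∧
    (∀ᵐ x ∂T.vol, g x ∈ dProj 0 1 (T.F α z a b v x)) ∧
    ∀ w : T.L2, M w =ᵐ[T.vol] fun x => w x - (b.1 x - a.1 x) * (g x * T.F' α a b w x)}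

end FEMesh

/-- `df`-semismoothness of order `μ` of a map `f` between normed spaces at the point `y`, for a
set-valued map `df` with nonempty images: `f` is continuous near `y` and
`sup_{M ∈ df (y + s)} ‖f (y + s) - f y - M s‖ = O(‖s‖ ^ (1 + μ))` as `s → 0`. -/
structure SemismoothAt {X Z : Type*} [NormedAddCommGroup X] [NormedSpace ℝ X]
    [NormedAddCommGroup Z] [NormedSpace ℝ Z] (f : X → Z) (df : X → Set (X →L[ℝ] Z)) (μ : ℝ)
    (y : X) : Prop where
  nonempty : ∀ x, (df x).Nonempty
  continuous : ∀ᶠ x in 𝓝 y, ContinuousAt f x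
  remainder : ∃ C : ℝ, ∀ᶠ s in 𝓝 (0 : X), ∀ M ∈ df (y + s),
    ‖f (y + s) - f y - M s‖ ≤ C * ‖s‖ ^ (1 + μ)

/-- `v` is a sequence of iterates of the semismooth Newton method for `f = 0` with invertible
generalized Jacobians `M n ∈ df (v n)` whose inverses are bounded by `C`. -/
structure IsNewtonSequence {X : Type*} [NormedAddCommGroup X] [NormedSpace ℝ X]
    (f : X → X) (df : X → Set (X →L[ℝ] X)) (C : ℝ) (M : ℕ → X ≃L[ℝ] X) (v : ℕ → X) : Prop where
  mem : ∀ n, (M n : X →L[ℝ] X) ∈ df (v n)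
  norm_inv_le : ∀ n, ‖((M n).symm : X →L[ℝ] X)‖ ≤ C
  step : ∀ n, M n (v (n + 1) - v n) = -f (v n)

end VarDisc

end

namespace VarDisc

/-! The adjoint state lies in the finite element space `Y_h`, so `q = -p_h(v)/α` is piecewise
affine. Replacing `v` by `v + s` adds to it a function `δ` in `Y_h`. As `Y_h` is finite dimensional,
the sup norm of `δ` is at most `ε = c‖s‖` (`exists_abs_le_norm`).

Up to sign, the linearization error of `G_h` at `x` is `P(q + δ) - P(q) - gδ`, with `g` taken at the
new point. It is at most `|δ|` (`abs_proj_remainder_le`) and vanishes unless `0 < |q - a| ≤ |δ|` or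
`0 < |q - b| ≤ |δ|` (`proj_remainder_eq_zero`). Cells on which `q` coincides with a bound thus do no
harm on account of that bound. On the remaining cells an affine function that is not identically
zero is small only on a set of measure `O(ε)` (`exists_vol_small_le`).

The `L²` norm of the error is therefore at most `ε · O(ε)^(1/2) = O(‖s‖^(3/2))`. This gives
semismoothness of every order up to `1/2`, and the standard Newton argument (`SemismoothAt.newton`)
applies. -/

/-! ### Linearization error of the scalar projection -/

theorem dProj_subset_Icc (a b x : ℝ) : dProj a b x ⊆ Icc 0 1 := by
  rintro g ⟨h0, h1, h2⟩
  by_cases hx : x ∈ Icc a b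
  · by_cases hxa : x = a ∨ x = b
    · exact h2 hxa
    · push Not at hxa
      rw [h1 ⟨lt_of_le_of_ne hx.1 (Ne.symm hxa.1), lt_of_le_of_ne hx.2 hxa.2⟩]
      simp
  · rw [h0 hx]; simp

/-- Rescaling the interval `[a, b]` to `[0, 1]` does not change the generalized differential. -/
theorem dProj_zero_one {a b : ℝ} (hab : a < b) (x : ℝ) :
    dProj 0 1 ((b - a)⁻¹ * (x - a)) = dProj a b x := by
  have h : 0 < b - a := sub_pos.2 hab
  have e : (b - a)⁻¹ * (x - a) = (x - a) / (b - a) := by rw [div_eq_inv_mul]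
  have h0 : (0 ≤ (x - a) / (b - a)) ↔ a ≤ x := by rw [le_div_iff₀ h]; simp
  have h1 : ((x - a) / (b - a) ≤ 1) ↔ x ≤ b := by rw [div_le_one h]; simp
  have h0' : (0 < (x - a) / (b - a)) ↔ a < x := by rw [lt_div_iff₀ h]; simp
  have h1' : ((x - a) / (b - a) < 1) ↔ x < b := by rw [div_lt_one h]; simp
  have h2 : ((x - a) / (b - a) = 0) ↔ x = a := by rw [div_eq_zero_iff]; grind
  have h3 : ((x - a) / (b - a) = 1) ↔ x = b := by rw [div_eq_one_iff_eq h.ne']; simp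
  rw [e]
  simp only [dProj, mem_Icc, mem_Ioo, h0, h1, h0', h1', h2, h3]

/-- The projection is monotone and 1-Lipschitz, so its increment lies between `0` and `δ`, and so
does `g * δ`. -/
theorem abs_proj_remainder_le {a b q δ g : ℝ} (hg : g ∈ Icc (0 : ℝ) 1) :
    |max a (min (q + δ) b) - max a (min q b) - g * δ| ≤ |δ| := by
  obtain ⟨h0, h1⟩ := hg
  rcases le_total 0 δ with h | h
  · have hD0 : max a (min q b) ≤ max a (min (q + δ) b) := by gcongr; linarith
    have hD1 : max a (min (q + δ) b) ≤ max a (min q b) + δ := by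
      simp only [max_def, min_def]; split_ifs <;> linarith
    have := mul_nonneg h0 h
    have := mul_le_of_le_one_left h h1
    rw [abs_of_nonneg h, abs_le]; constructor <;> linarith
  · have hD0 : max a (min (q + δ) b) ≤ max a (min q b) := by gcongr; linarith
    have hD1 : max a (min q b) + δ ≤ max a (min (q + δ) b) := by
      simp only [max_def, min_def]; split_ifs <;> linarith
    have := mul_nonneg_of_nonpos_of_nonpos h (sub_nonpos.2 h1)
    have := mul_nonpos_of_nonneg_of_nonpos h0 h
    rw [abs_of_nonpos h, abs_le]; constructor <;> nlinarith

/-- The linearization error of the projection vanishes unless the increment reaches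
an endpoint of the interval other than the base point. -/
theorem proj_remainder_eq_zero {a b q δ g : ℝ} (hab : a < b) (hg : g ∈ dProj a b (q + δ))
    (ha : q ≠ a → |δ| < |q - a|) (hb : q ≠ b → |δ| < |q - b|) :
    max a (min (q + δ) b) - max a (min q b) - g * δ = 0 := by
  obtain ⟨h0, h1, -⟩ := hg
  simp only [mem_Icc, mem_Ioo, not_and, not_le, and_imp] at h0 h1
  -- A step too short to reach an endpoint leaves `q` weakly on the same side of it as `q + δ`. Both
  -- points then lie in the closure of one affine piece.
  have key : ∀ c, (q ≠ c → |δ| < |q - c|) → (q + δ ≤ c → q ≤ c) ∧ (c ≤ q + δ → c ≤ q) := by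
    intro c hc
    refine ⟨fun h => ?_, fun h => ?_⟩ <;> by_contra! h'
    · have := hc h'.ne'
      rw [abs_of_pos (sub_pos.2 h')] at this
      linarith [neg_abs_le δ]
    · have := hc h'.ne
      rw [abs_of_neg (sub_neg.2 h')] at this
      linarith [le_abs_self δ]
  obtain ⟨ha1, ha2⟩ := key a ha
  obtain ⟨hb1, hb2⟩ := key b hb
  rcases lt_trichotomy (q + δ) a with h | h | h
  · rw [h0 fun h' => by linarith, min_eq_left (by linarith), min_eq_left (by linarith [ha1 h.le]),
      max_eq_left h.le, max_eq_left (ha1 h.le)]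
    simp
  -- If the new point is an endpoint, it did not move, so the free choice of `g` there is harmless.
  · have hq : q = a := le_antisymm (ha1 h.le) (ha2 h.ge)
    have hδ : δ = 0 := by linarith
    simp [hδ]
  rcases lt_trichotomy (q + δ) b with h' | h' | h'
  · rw [h1 h h', min_eq_left h'.le, min_eq_left (hb1 h'.le), max_eq_right h.le,
      max_eq_right (ha2 h.le)]
    ring
  · have hq : q = b := le_antisymm (hb1 h'.le) (hb2 h'.ge)
    have hδ : δ = 0 := by linarith
    simp [hδ]
  · rw [h0 fun _ => h', min_eq_right h'.le, min_eq_right (hb2 h'.le)]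
    simp

/-! ### Superlinear convergence of Newton's method -/

/-- Local convergence of the semismooth Newton method. -/
theorem SemismoothAt.newton {X : Type*} [NormedAddCommGroup X] [NormedSpace ℝ X]
    {f : X → X} {df : X → Set (X →L[ℝ] X)} {μ : ℝ} {u : X} (h : SemismoothAt f df μ u)
    (hμ : 0 < μ) (hu : f u = 0) (C : ℝ) :
    ∃ δ > 0, ∃ K : ℝ, ∀ (M : ℕ → X ≃L[ℝ] X) (v : ℕ → X), ‖v 0 - u‖ < δ →
      IsNewtonSequence f df C M v →
        Tendsto v atTop (𝓝 u) ∧ ∀ n, ‖v (n + 1) - u‖ ≤ K * ‖v n - u‖ ^ (1 + μ) := by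
  obtain ⟨C', hC'⟩ := h.remainder
  obtain ⟨r, hr, hball⟩ := Metric.eventually_nhds_iff.1 hC'
  -- `C` and `C'` are arbitrary reals; truncating at `0` makes the products monotone.
  set K : ℝ := max C 0 * max C' 0 with hK
  have hK0 : 0 ≤ K := by positivity
  -- Since `μ > 0`, the contraction factor `K‖v n - u‖ ^ μ` drops below `1/2` near `u`, which keeps
  -- the iterates in the ball.
  have hlim : Tendsto (fun t : ℝ => K * t ^ μ) (𝓝 0) (𝓝 0) := by
    have h1 : ContinuousAt (fun t : ℝ => K * t ^ μ) 0 :=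
      continuousAt_const.mul (Real.continuousAt_rpow_const _ _ (Or.inr hμ.le))
    simpa [ContinuousAt, Real.zero_rpow hμ.ne'] using h1
  obtain ⟨t, ht, hball'⟩ := Metric.eventually_nhds_iff.1
    (hlim.eventually (gt_mem_nhds (show (0 : ℝ) < 1 / 2 by norm_num)))
  refine ⟨min r t, lt_min hr ht, K, fun M v hv0 hN => ?_⟩
  have hstep : ∀ n, ‖v n - u‖ < r → ‖v (n + 1) - u‖ ≤ K * ‖v n - u‖ ^ (1 + μ) := by
    intro n hn
    have hrem := @hball (v n - u) (by simpa using hn) (M n) (by simpa using hN.mem n)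
    rw [add_sub_cancel, hu, sub_zero] at hrem
    -- As `f u = 0`, the new error is the inverse Jacobian applied to minus the semismoothness
    -- remainder.
    have hid : v (n + 1) - u = (M n).symm (-(f (v n) - M n (v n - u))) := by
      rw [ContinuousLinearEquiv.eq_symm_apply, neg_sub, sub_eq_add_neg _ (f (v n)), ← hN.step n,
        ← map_add]
      congr 1; abel
    calc ‖v (n + 1) - u‖ ≤ ‖((M n).symm : X →L[ℝ] X)‖ * ‖-(f (v n) - M n (v n - u))‖ := by
          rw [hid]; exact ((M n).symm : X →L[ℝ] X).le_opNorm _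
      _ ≤ max C 0 * (max C' 0 * ‖v n - u‖ ^ (1 + μ)) := by
          rw [norm_neg]
          gcongr
          · exact (hN.norm_inv_le n).trans (le_max_left _ _)
          · refine hrem.trans ?_
            gcongr
            exact le_max_left _ _
      _ = K * ‖v n - u‖ ^ (1 + μ) := by rw [hK]; ring
  have hhalf : ∀ n, ‖v n - u‖ < min r t → ‖v (n + 1) - u‖ ≤ 1 / 2 * ‖v n - u‖ := by
    intro n hn
    have h1 : K * ‖v n - u‖ ^ μ < 1 / 2 := @hball' ‖v n - u‖ (by
      simpa using hn.trans_le (min_le_right _ _))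
    refine (hstep n (hn.trans_le (min_le_left _ _))).trans ?_
    rw [add_comm, Real.rpow_add_one' (norm_nonneg _) (by positivity), ← mul_assoc]
    gcongr
  have hall : ∀ n, ‖v n - u‖ < min r t ∧ ‖v n - u‖ ≤ (1 / 2) ^ n * ‖v 0 - u‖ := by
    intro n
    induction n with
    | zero => simpa using hv0
    | succ n ih =>
      have h1 := hhalf n ih.1
      refine ⟨by linarith [ih.1, norm_nonneg (v n - u)], h1.trans ?_⟩
      rw [pow_succ']
      linarith [ih.2]
  refine ⟨?_, fun n => hstep n ((hall n).1.trans_le (min_le_left _ _))⟩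
  rw [tendsto_iff_norm_sub_tendsto_zero]
  refine squeeze_zero (fun _ => norm_nonneg _) (fun n => (hall n).2) ?_
  simpa using (tendsto_pow_atTop_nhds_zero_of_lt_one (r := (1 / 2 : ℝ))
    (by norm_num) (by norm_num)).mul_const ‖v 0 - u‖

end VarDisc

namespace VarDisc

/-! ### Finite element functions: small values and sup norms -/

/-- The intersection of a bounded set with the slab `{|ℓ + c| ≤ ε}` around a hyperplane has measure
`O(ε)`. -/
theorem exists_volume_slab_le {d : ℕ} (ℓ : EuclideanSpace ℝ (Fin d) →ₗ[ℝ] ℝ) (hℓ : ℓ ≠ 0) (c : ℝ)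
    {K : Set (EuclideanSpace ℝ (Fin d))} (hK : Bornology.IsBounded K) :
    ∃ C : ℝ, 0 ≤ C ∧ ∀ ε, 0 ≤ ε → volume {x | x ∈ K ∧ |ℓ x + c| ≤ ε} ≤ ENNReal.ofReal (C * ε) := by
  obtain ⟨R, hR0, hR⟩ := hK.exists_pos_norm_le
  obtain ⟨i, hi⟩ : ∃ i, ℓ (EuclideanSpace.single i 1) ≠ 0 := by
    by_contra! h
    exact hℓ ((EuclideanSpace.basisFun (Fin d) ℝ).toBasis.ext fun i => by simpa using h i)
  have hsplit : ∀ x : EuclideanSpace ℝ (Fin d), x i = 0 → (∀ j, j ≠ i → x j = 0) → x = 0 := by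
    intro x h1 h2
    ext j
    by_cases hj : j = i
    · rw [hj]; exact h1
    · exact h2 j hj
  -- the shear replacing the `i`-th coordinate by `ℓ`
  let f : EuclideanSpace ℝ (Fin d) →ₗ[ℝ] EuclideanSpace ℝ (Fin d) :=
    LinearMap.id +
      (ℓ - (EuclideanSpace.proj i : EuclideanSpace ℝ (Fin d) →L[ℝ] ℝ).toLinearMap).smulRight
        (EuclideanSpace.single i 1)
  have hfi : ∀ x, f x i = ℓ x := fun x => by simp [f]
  have hfj : ∀ x j, j ≠ i → f x j = x j := fun x j hj => by simp [f, hj]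
  -- A kernel vector is a multiple of the `i`-th unit vector, on which `ℓ` does not vanish.
  have hker : LinearMap.ker f = ⊥ := by
    rw [LinearMap.ker_eq_bot']
    intro x hx
    have hxj : ∀ j, j ≠ i → x j = 0 := fun j hj => by rw [← hfj x j hj, hx]; rfl
    have hxs : x = x i • EuclideanSpace.single i 1 := by
      ext j
      by_cases hj : j = i
      · subst hj; simp
      · simp [hj, hxj j hj]
    refine hsplit x ?_ hxj
    have h0 : ℓ x = 0 := by rw [← hfi x, hx]; rfl
    rw [hxs, map_smul, smul_eq_mul] at h0
    exact (mul_eq_zero.1 h0).resolve_right hi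
  have hdet : LinearMap.det f ≠ 0 := fun h => (LinearMap.bot_lt_ker_of_det_eq_zero h).ne' hker
  -- The shear sends the slab into a box of width `2 * ε` in direction `i` and `2 * R` in the
  -- others.
  let lo (ε : ℝ) : Fin d → ℝ := fun j => if j = i then -c - ε else -R
  let hi (ε : ℝ) : Fin d → ℝ := fun j => if j = i then -c + ε else R
  refine ⟨|(LinearMap.det f)⁻¹| * (2 * ∏ j ∈ Finset.univ.erase i, (2 * R)), by positivity,
    fun ε hε => ?_⟩
  have hsub : {x | x ∈ K ∧ |ℓ x + c| ≤ ε} ⊆ f ⁻¹' ((WithLp.ofLp) ⁻¹' Icc (lo ε) (hi ε)) := by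
    rintro x ⟨hxK, hx⟩
    rw [abs_le] at hx
    have hcoord : ∀ j, lo ε j ≤ f x j ∧ f x j ≤ hi ε j := by
      intro j
      by_cases hj : j = i
      · subst hj
        simp only [lo, hi, if_true, hfi]
        constructor <;> linarith
      · simp only [lo, hi, if_neg hj, hfj x j hj]
        exact abs_le.1 ((PiLp.norm_apply_le x j).trans (hR x hxK))
    exact ⟨fun j => (hcoord j).1, fun j => (hcoord j).2⟩
  refine (measure_mono hsub).trans ?_
  rw [Measure.addHaar_preimage_linearMap _ hdet,
    (PiLp.volume_preserving_ofLp (Fin d)).measure_preimage measurableSet_Icc.nullMeasurableSet,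
    Real.volume_Icc_pi, ← Finset.mul_prod_erase _ _ (Finset.mem_univ i),
    mul_assoc, ENNReal.ofReal_mul (abs_nonneg _)]
  gcongr
  rw [← ENNReal.ofReal_prod_of_nonneg, ← ENNReal.ofReal_mul (by simp [lo, hi]; linarith)]
  · refine ENNReal.ofReal_le_ofReal (le_of_eq ?_)
    have : ∏ j ∈ Finset.univ.erase i, (hi ε j - lo ε j) = ∏ j ∈ Finset.univ.erase i, (2 * R) :=
      Finset.prod_congr rfl fun j hj => by
        simp only [lo, hi, if_neg (Finset.ne_of_mem_erase hj)]; ring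
    rw [this]
    simp only [lo, hi, if_true]
    ring
  · intro j hj
    simp only [lo, hi, if_neg (Finset.ne_of_mem_erase hj)]
    linarith

namespace FEMesh

variable {d : ℕ} (T : FEMesh d)

/-- A finite element function is small but nonzero only on a small set. -/
theorem exists_vol_small_le {φ : EuclideanSpace ℝ (Fin d) → ℝ} (hφ : φ ∈ T.W) :
    ∃ C : ℝ, 0 ≤ C ∧ ∀ ε, 0 ≤ ε → T.vol {x | φ x ≠ 0 ∧ |φ x| ≤ ε} ≤ ENNReal.ofReal (C * ε) := by
  have hcell : ∀ s ∈ T.cells, ∃ C : ℝ, 0 ≤ C ∧ ∀ ε, 0 ≤ ε →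
      volume {x | x ∈ convexHull ℝ (s : Set (EuclideanSpace ℝ (Fin d))) ∧ φ x ≠ 0 ∧ |φ x| ≤ ε} ≤
        ENNReal.ofReal (C * ε) := by
    intro s hs
    obtain ⟨A, hA⟩ := hφ.2 s hs
    have hK := s.finite_toSet.isCompact_convexHull ℝ
    have hdec : ∀ x, A x = A.linear x + A 0 := fun x => by
      simpa using congrFun (AffineMap.decomp A) x
    -- On a cell `φ` is zero (excluded by `φ x ≠ 0`), a nonzero constant, or nonconstant, where the
    -- slab bound applies.
    by_cases hlin : A.linear = 0
    · by_cases h0 : A 0 = 0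
      · refine ⟨0, le_rfl, fun ε _ => ?_⟩
        refine (measure_mono_null ?_ measure_empty).le.trans zero_le
        rintro x ⟨hx, hx', -⟩
        exact hx' (by rw [hA hx, hdec]; simp [hlin, h0])
      -- For a nonzero constant the set is empty until `ε` reaches `|A 0|`; from then on this
      -- constant times `ε` exceeds the volume of the cell.
      · refine ⟨volume.real (convexHull ℝ (s : Set (EuclideanSpace ℝ (Fin d)))) / |A 0|,
          by positivity, fun ε hε => ?_⟩
        by_cases hle : |A 0| ≤ ε
        · refine (measure_mono fun x hx => hx.1).trans ?_
          rw [← ofReal_measureReal hK.measure_ne_top]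
          refine ENNReal.ofReal_le_ofReal ?_
          rw [div_mul_eq_mul_div, le_div_iff₀ (abs_pos.2 h0)]
          gcongr
        · refine (measure_mono_null ?_ measure_empty).le.trans zero_le
          rintro x ⟨hx, -, hx'⟩
          rw [hA hx, hdec] at hx'
          simp only [hlin, LinearMap.zero_apply, zero_add] at hx'
          exact hle hx'
    · obtain ⟨C, hC0, hC⟩ := exists_volume_slab_le A.linear hlin (A 0) hK.isBounded
      refine ⟨C, hC0, fun ε hε => (measure_mono ?_).trans (hC ε hε)⟩
      rintro x ⟨hx, -, hx'⟩
      rw [hA hx, hdec] at hx'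
      exact ⟨hx, hx'⟩
  choose! C hC0 hC using hcell
  refine ⟨∑ s ∈ T.finite_cells.toFinset, C s,
    Finset.sum_nonneg fun s hs => hC0 s (T.finite_cells.mem_toFinset.1 hs), fun ε hε => ?_⟩
  rw [Measure.restrict_apply' T.isOpen_dom.measurableSet]
  have hsub : {x | φ x ≠ 0 ∧ |φ x| ≤ ε} ∩ T.dom ⊆ ⋃ s ∈ T.finite_cells.toFinset,
      {x | x ∈ convexHull ℝ (s : Set (EuclideanSpace ℝ (Fin d))) ∧ φ x ≠ 0 ∧ |φ x| ≤ ε} := by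
    rintro x ⟨hx, hxd⟩
    have hx' := subset_closure hxd
    rw [T.closure_dom] at hx'
    simp only [mem_iUnion, exists_prop] at hx'
    obtain ⟨s, hs, hxs⟩ := hx'
    exact mem_biUnion (T.finite_cells.mem_toFinset.2 hs) ⟨hxs, hx⟩
  refine (measure_mono hsub).trans ((measure_biUnion_finset_le _ _).trans ?_)
  rw [Finset.sum_mul, ENNReal.ofReal_sum_of_nonneg fun s hs =>
    mul_nonneg (hC0 s (T.finite_cells.mem_toFinset.1 hs)) hε]
  exact Finset.sum_le_sum fun s hs => hC s (T.finite_cells.mem_toFinset.1 hs) ε hε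

/-- On the finite dimensional space `Y_h` the supremum norm is bounded by the `L²` norm. -/
theorem exists_abs_le_norm : ∃ C : ℝ, 0 ≤ C ∧ ∀ (φ : T.Y) (x : EuclideanSpace ℝ (Fin d)),
    |φ.1 x| ≤ C * ‖T.YtoL2 φ‖ := by
  have hbdd : ∀ φ : T.Y, ∃ C, ∀ x, ‖φ.1 x‖ ≤ C := by
    intro φ
    obtain ⟨C, hC⟩ := T.isCompact_closure.exists_bound_of_continuousOn φ.2.1.1
    refine ⟨max C 0, fun x => ?_⟩
    by_cases hx : x ∈ T.dom
    · exact (hC x (subset_closure hx)).trans (le_max_left _ _)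
    · rw [φ.2.2 x hx]; simp
  choose B hB using hbdd
  -- The range of `Y_h` in `L²` is a finite dimensional normed space, so its linear map into bounded
  -- continuous functions is bounded.
  let e := LinearEquiv.ofInjective T.YtoL2 T.YtoL2_injective
  let j : T.Y →ₗ[ℝ] BoundedContinuousFunction (EuclideanSpace ℝ (Fin d)) ℝ :=
    { toFun := fun φ => BoundedContinuousFunction.ofNormedAddCommGroup φ.1
        (T.continuous_of_mem_Y φ.2) (B φ) (hB φ)
      map_add' := fun _ _ => rfl
      map_smul' := fun _ _ => rfl }
  let Φ := LinearMap.toContinuousLinearMap (j ∘ₗ e.symm.toLinearMap)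
  refine ⟨‖Φ‖, Φ.opNorm_nonneg, fun φ x => ?_⟩
  have h1 : Φ (e φ) = j φ := by simp [Φ]
  calc |φ.1 x| = ‖j φ x‖ := rfl
    _ ≤ ‖j φ‖ := (j φ).norm_coe_le_norm x
    _ ≤ ‖Φ‖ * ‖e φ‖ := by rw [← h1]; exact Φ.le_opNorm _
    _ = ‖Φ‖ * ‖T.YtoL2 φ‖ := rfl

end FEMesh
end VarDisc

namespace VarDisc
namespace FEMesh

variable {d : ℕ} (T : FEMesh d)

/-! ### Semismoothness of `G_h` -/

theorem coeFn_WtoL2 (φ : T.W) : T.WtoL2 φ =ᵐ[T.vol] (φ : EuclideanSpace ℝ (Fin d) → ℝ) :=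
  MemLp.coeFn_toLp (T.memLp_of_mem_W φ.2)

variable [NeZero d] (α : ℝ) (z : T.L2) (a b : T.W)

/-- This is the adjoint state for control `0` and desired state `-w`. It places `S_h^* S_h s` in
`Y_h`, where the sup norm bound is available. -/
theorem Sadj_eq (w : T.L2) : T.Sadj w = T.YtoL2 (T.solve w) := by
  simpa [adjointState] using T.adjointState_eq (-w) 0

theorem adjointState_add (v s : T.L2) :
    T.adjointState z (v + s) = T.adjointState z v + T.Sadj (T.S s) := by
  simp only [adjointState, ← map_add]
  congr 1
  rw [map_add]; abel

theorem coeFn_G (v : T.L2) : T.G α z a b v =ᵐ[T.vol] fun x =>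
    v x - max (a.1 x) (min (-(1 / α) * T.adjointState z v x) (b.1 x)) := by
  filter_upwards [Lp.coeFn_sub v (T.WtoL2 a ⊔ ((-(1 / α)) • T.adjointState z v ⊓ T.WtoL2 b)),
    Lp.coeFn_sup (T.WtoL2 a) ((-(1 / α)) • T.adjointState z v ⊓ T.WtoL2 b),
    Lp.coeFn_inf ((-(1 / α)) • T.adjointState z v) (T.WtoL2 b),
    Lp.coeFn_smul (-(1 / α)) (T.adjointState z v), T.coeFn_WtoL2 a, T.coeFn_WtoL2 b]
    with x h1 h2 h3 h4 h5 h6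
  rw [G, h1, Pi.sub_apply, h2, Pi.sup_apply, h3, Pi.inf_apply, h4, h5, h6]
  rfl

theorem continuous_G : Continuous (T.G α z a b) := by
  have hp : Continuous (T.adjointState z) :=
    T.Sadj.continuous.comp (T.S.continuous.sub continuous_const)
  exact continuous_id.sub (continuous_const.sup ((hp.const_smul (-(1 / α))).inf continuous_const))

variable {a b}

/-- The generalized differential of `G_h` in terms of the projection onto `[a, b]`. -/
theorem mem_dG_iff (hab : ∀ x ∈ T.dom, a.1 x < b.1 x) (v : T.L2) (M : T.L2 →L[ℝ] T.L2) :
    M ∈ T.dG α z a b v ↔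
      ∃ g : EuclideanSpace ℝ (Fin d) → ℝ, AEStronglyMeasurable g T.vol ∧
        (∀ᵐ x ∂T.vol, g x ∈ dProj (a.1 x) (b.1 x) (-(1 / α) * T.adjointState z v x)) ∧
        ∀ w : T.L2, M w =ᵐ[T.vol] fun x => w x + 1 / α * (g x * T.Sadj (T.S w) x) := by
  have hlt : ∀ᵐ x ∂T.vol, a.1 x < b.1 x :=
    (ae_restrict_mem T.isOpen_dom.measurableSet).mono hab
  refine exists_congr fun g => and_congr Iff.rfl (and_congr ?_ (forall_congr' fun w => ?_))
  · refine eventually_congr (hlt.mono fun x hx => ?_)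
    rw [F, dProj_zero_one hx]
  · have h : (fun x => w x - (b.1 x - a.1 x) * (g x * T.F' α a b w x)) =ᵐ[T.vol]
        fun x => w x + 1 / α * (g x * T.Sadj (T.S w) x) := by
      filter_upwards [hlt] with x hx
      have : b.1 x - a.1 x ≠ 0 := (sub_pos.2 hx).ne'
      rw [F']
      field_simp
      ring
    exact ⟨fun h' => h'.trans h, fun h' => h'.trans h.symm⟩

theorem dG_nonempty (hab : ∀ x ∈ T.dom, a.1 x < b.1 x) (v : T.L2) :
    (T.dG α z a b v).Nonempty := by
  -- The selection equal to `1` on the closed interval is admissible. The `L²` representatives of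
  -- `a` and `b` make this set measurable.
  let A : Set (EuclideanSpace ℝ (Fin d)) := {x | T.WtoL2 a x ≤ -(1 / α) * T.adjointState z v x} ∩
    {x | -(1 / α) * T.adjointState z v x ≤ T.WtoL2 b x}
  have hp : Measurable fun x => -(1 / α) * T.adjointState z v x :=
    (Lp.stronglyMeasurable _).measurable.const_mul _
  have hA : MeasurableSet A :=
    (measurableSet_le (Lp.stronglyMeasurable _).measurable hp).inter
      (measurableSet_le hp (Lp.stronglyMeasurable _).measurable)
  let g : EuclideanSpace ℝ (Fin d) → ℝ := A.indicator fun _ => 1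
  -- Hölder's inequality makes multiplication by the `L^∞` function `g` bounded on `L²`.
  let B : T.L2 →L[ℝ] T.L2 := (ContinuousLinearMap.mul ℝ ℝ).holderL T.vol ⊤ 2 2
    (indicatorConstLp ⊤ hA (measure_ne_top _ _) 1)
  have hB : ∀ w : T.L2, B w =ᵐ[T.vol] fun x => g x * w x := by
    intro w
    filter_upwards [ContinuousLinearMap.coeFn_holder (r := 2) (ContinuousLinearMap.mul ℝ ℝ)
      (indicatorConstLp ⊤ hA (measure_ne_top T.vol _) (1 : ℝ)) w,
      indicatorConstLp_coeFn (p := ⊤) (hs := hA) (hμs := measure_ne_top T.vol _) (c := (1 : ℝ))]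
      with x h1 h2
    refine h1.trans ?_
    rw [h2]
    rfl
  refine ⟨ContinuousLinearMap.id ℝ _ + (1 / α) • (B ∘L T.Sadj ∘L T.S),
    (T.mem_dG_iff α z hab v _).2 ⟨g, (stronglyMeasurable_const.indicator hA).aestronglyMeasurable,
      ?_, fun w => ?_⟩⟩
  · filter_upwards [T.coeFn_WtoL2 a, T.coeFn_WtoL2 b] with x h1 h2
    have hxA : x ∈ A ↔ -(1 / α) * T.adjointState z v x ∈ Icc (a.1 x) (b.1 x) := by
      rw [← h1, ← h2]; rfl
    refine ⟨fun h => ?_, fun h => ?_, fun _ => ?_⟩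
    · exact indicator_of_notMem (mt hxA.1 h) _
    · exact indicator_of_mem (hxA.2 (Ioo_subset_Icc_self h)) _
    · by_cases hx : x ∈ A <;> simp [g, hx]
  · filter_upwards [Lp.coeFn_add w ((1 / α) • B (T.Sadj (T.S w))),
      Lp.coeFn_smul (1 / α) (B (T.Sadj (T.S w))), hB (T.Sadj (T.S w))] with x h1 h2 h3
    refine h1.trans ?_
    rw [Pi.add_apply, h2, Pi.smul_apply, h3]
    rfl

/-- The core estimate: an error of size `O(‖s‖)` supported on a set of measure `O(‖s‖)`. -/
theorem exists_norm_remainder_le (hab : ∀ x ∈ T.dom, a.1 x < b.1 x) (v : T.L2) :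
    ∃ C : ℝ, 0 ≤ C ∧ ∀ s : T.L2, ∀ M ∈ T.dG α z a b (v + s),
      ‖T.G α z a b (v + s) - T.G α z a b v - M s‖ ≤ C * ‖s‖ ^ (3 / 2 : ℝ) := by
  let q : T.Y := -(1 / α) • T.solve (T.S v - z)
  have hq : ∀ᵐ x ∂T.vol, q.1 x = -(1 / α) * T.adjointState z v x := by
    filter_upwards [T.coeFn_YtoL2 (T.solve (T.S v - z))] with x hx
    rw [T.adjointState_eq, hx]; rfl
  have hqa : q.1 - a.1 ∈ T.W := T.W.sub_mem q.2.1 a.2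
  have hqb : q.1 - b.1 ∈ T.W := T.W.sub_mem q.2.1 b.2
  obtain ⟨Ca, hCa0, hCa⟩ := T.exists_vol_small_le hqa
  obtain ⟨Cb, hCb0, hCb⟩ := T.exists_vol_small_le hqb
  obtain ⟨C, hC0, hC⟩ := T.exists_abs_le_norm
  set c : ℝ := |1 / α| * (C * ‖T.Sadj ∘L T.S‖) with hc
  have hc0 : 0 ≤ c := by positivity
  refine ⟨c * ((Ca + Cb) * c) ^ (1 / 2 : ℝ), by positivity, fun s M hM => ?_⟩
  set ε : ℝ := c * ‖s‖ with hε
  have hε0 : 0 ≤ ε := by positivity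
  have hδ : ∀ᵐ x ∂T.vol, |-(1 / α) * T.Sadj (T.S s) x| ≤ ε := by
    filter_upwards [T.coeFn_YtoL2 (T.solve (T.S s))] with x hx
    have h1 := hC (T.solve (T.S s)) x
    rw [← hx, ← T.Sadj_eq] at h1
    rw [abs_mul, abs_neg, hε, hc, mul_assoc, mul_assoc]
    gcongr
    refine h1.trans ?_
    gcongr
    exact (T.Sadj ∘L T.S).le_opNorm s
  -- Only here can a step of size at most `ε` reach an endpoint other than `q` itself.
  let A : Set (EuclideanSpace ℝ (Fin d)) :=
    {x | (q.1 - a.1) x ≠ 0 ∧ |(q.1 - a.1) x| ≤ ε} ∪ {x | (q.1 - b.1) x ≠ 0 ∧ |(q.1 - b.1) x| ≤ ε}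
  have hA : T.vol A ≤ ENNReal.ofReal ((Ca + Cb) * ε) := by
    refine (measure_union_le _ _).trans ?_
    rw [add_mul, ENNReal.ofReal_add (by positivity) (by positivity)]
    exact add_le_add (hCa ε hε0) (hCb ε hε0)
  have hA' : T.vol.real (toMeasurable T.vol A) ≤ (Ca + Cb) * ε := by
    rw [measureReal_def, measure_toMeasurable]
    exact ENNReal.toReal_le_of_le_ofReal (by positivity) hA
  -- The measurable hull has the same measure as `A` and supports an `L²` indicator dominating the
  -- error.
  have hae : ∀ᵐ x ∂T.vol, ‖(T.G α z a b (v + s) - T.G α z a b v - M s : T.L2) x‖ ≤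
      ‖indicatorConstLp 2 (measurableSet_toMeasurable T.vol A) (measure_ne_top T.vol _) ε x‖ := by
    obtain ⟨g, -, hg, hMg⟩ := (T.mem_dG_iff α z hab (v + s) M).1 hM
    filter_upwards [hq, hδ, hg, hMg s, T.coeFn_G α z a b v, T.coeFn_G α z a b (v + s),
      Lp.coeFn_sub (T.G α z a b (v + s) - T.G α z a b v) (M s),
      Lp.coeFn_sub (T.G α z a b (v + s)) (T.G α z a b v), Lp.coeFn_add v s,
      Lp.coeFn_add (T.adjointState z v) (T.Sadj (T.S s)),
      ae_restrict_mem T.isOpen_dom.measurableSet,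
      indicatorConstLp_coeFn (p := 2) (hs := measurableSet_toMeasurable T.vol A)
        (hμs := measure_ne_top T.vol _) (c := ε)]
      with x h1 h2 h3 h4 h5 h6 h7 h8 h9 h10 h11 h12
    have hp : -(1 / α) * T.adjointState z (v + s) x =
        q.1 x + -(1 / α) * T.Sadj (T.S s) x := by
      rw [T.adjointState_add, h10, h1, Pi.add_apply]; ring
    rw [hp] at h3 h6
    rw [← h1] at h5
    have hr : (T.G α z a b (v + s) - T.G α z a b v - M s : T.L2) x =
        -(max (a.1 x) (min (q.1 x + -(1 / α) * T.Sadj (T.S s) x) (b.1 x)) -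
          max (a.1 x) (min (q.1 x) (b.1 x)) - g x * (-(1 / α) * T.Sadj (T.S s) x)) := by
      rw [h7, Pi.sub_apply, h8, Pi.sub_apply, h4, h5, h6, h9, Pi.add_apply]; ring
    rw [hr, norm_neg, h12]
    by_cases hx : x ∈ A
    · rw [indicator_of_mem (subset_toMeasurable _ _ hx), Real.norm_eq_abs, Real.norm_eq_abs,
        abs_of_nonneg hε0]
      exact (abs_proj_remainder_le (dProj_subset_Icc _ _ _ h3)).trans h2
    · rw [proj_remainder_eq_zero (hab x h11) h3, norm_zero]
      · exact norm_nonneg _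
      · intro hne
        by_contra! hle
        exact hx (Or.inl ⟨sub_ne_zero.2 hne, hle.trans h2⟩)
      · intro hne
        by_contra! hle
        exact hx (Or.inr ⟨sub_ne_zero.2 hne, hle.trans h2⟩)
  refine (Lp.norm_le_norm_of_ae_le hae).trans ?_
  rw [norm_indicatorConstLp (by norm_num) (by norm_num), Real.norm_of_nonneg hε0]
  calc ε * T.vol.real (toMeasurable T.vol A) ^ (1 / (2 : ENNReal).toReal)
      ≤ ε * ((Ca + Cb) * ε) ^ (1 / 2 : ℝ) := by
        rw [ENNReal.toReal_ofNat]
        gcongr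
    _ = c * ((Ca + Cb) * c) ^ (1 / 2 : ℝ) * ‖s‖ ^ (3 / 2 : ℝ) := by
        rw [hε, ← mul_assoc (Ca + Cb), Real.mul_rpow (by positivity) (norm_nonneg _),
          show (3 / 2 : ℝ) = 1 + 1 / 2 by norm_num, Real.rpow_one_add' (norm_nonneg _) (by norm_num)]
        ring

theorem semismoothAt_G (hab : ∀ x ∈ T.dom, a.1 x < b.1 x) {μ : ℝ} (hμ0 : 0 < μ) (hμ : μ ≤ 1 / 2)
    (v : T.L2) : SemismoothAt (T.G α z a b) (T.dG α z a b) μ v where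
  nonempty := T.dG_nonempty α z hab
  continuous := .of_forall fun _ => (T.continuous_G α z a b).continuousAt
  remainder := by
    obtain ⟨C, hC0, hC⟩ := T.exists_norm_remainder_le α z hab v
    refine ⟨C, ?_⟩
    filter_upwards [Metric.ball_mem_nhds (0 : T.L2) one_pos] with s hs M hM
    refine (hC s M hM).trans ?_
    refine mul_le_mul_of_nonneg_left ?_ hC0
    -- For `‖s‖ ≤ 1` the larger exponent `3/2` gives the smaller power; the side condition at base
    -- `0` holds because `1 + μ ≠ 0`.
    refine Real.rpow_le_rpow_of_exponent_ge_of_imp (norm_nonneg _) (mem_ball_zero_iff.1 hs).le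
      (by linarith) fun _ h => ?_
    linarith

end FEMesh
end VarDisc

theorem mainTheorem1 (d : ℕ) [NeZero d] (T : VarDisc.FEMesh d) (α : ℝ) (hα : 0 < α)
    (z : T.L2) (a b : T.W) (hab : ∀ x ∈ T.dom, a.1 x < b.1 x) :
    -- formula for the generalized derivative
    (∀ (v : T.L2) (M : T.L2 →L[ℝ] T.L2), M ∈ T.dG α z a b v ↔
      ∃ g : EuclideanSpace ℝ (Fin d) → ℝ, AEStronglyMeasurable g T.vol ∧
        (∀ᵐ x ∂T.vol,
          g x ∈ VarDisc.dProj (a.1 x) (b.1 x) (-(1 / α) * T.adjointState z v x)) ∧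
        ∀ w : T.L2, M w =ᵐ[T.vol] fun x => w x + 1 / α * (g x * T.Sadj (T.S w) x)) ∧
    ∀ μ : ℝ, 0 < μ → μ < 1 / 3 →
      -- semismoothness of order μ
      (∀ v : T.L2, VarDisc.SemismoothAt (T.G α z a b) (T.dG α z a b) μ v) ∧
      -- local superlinear convergence of the semismooth Newton method
      (∀ u : T.L2, T.G α z a b u = 0 → ∀ C : ℝ, ∃ δ > 0, ∃ K : ℝ,
        ∀ (M : ℕ → T.L2 ≃L[ℝ] T.L2) (v : ℕ → T.L2), ‖v 0 - u‖ < δ →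
          VarDisc.IsNewtonSequence (T.G α z a b) (T.dG α z a b) C M v →
          Tendsto v atTop (𝓝 u) ∧ ∀ n, ‖v (n + 1) - u‖ ≤ K * ‖v n - u‖ ^ (1 + μ)) := by
  refine ⟨T.mem_dG_iff α z hab, fun μ hμ0 hμ => ?_⟩
  -- The range `μ < 1/3` lies inside the range `μ ≤ 1/2` obtained above.
  have hss := T.semismoothAt_G α z hab hμ0 (hμ.le.trans (by norm_num))
  exact ⟨hss, fun u hu C => (hss u).newton hμ0 hu C⟩
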